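/- Let $\kappa\in\mathbb R$ and let $M^2_\kappa$ be the complete simply connected surface of constant curvature $\kappa$ (a round sphere of radius $1/\sqrt\kappa$, the Euclidean plane, or a rescaled hyperbolic plane). Let $T$ be a non-degenerate geodesic triangle in $M^2_\kappa$, that is, three points not lying on a common geodesic line, joined pairwise by minimal geodesic segments; if $\kappa>0$, assume in addition that the three vertices lie in a common open hemisphere. Define the iterated medial subdivisions $T_0,T_1,T_2,\dots$ of $T$ as follows: $T_0$ consists of the single triangle $T$, and $T_{n+1}$ is obtained from $T_n$ by replacing each triangle of $T_n$ by the four triangles into which it is cut by the three minimal geodesic segments joining pairwise the midpoints of its sides. Then there exists $\delta>0$ such that for every $n\ge 0$ every angle of every triangle of $T_n$ lies in the open interval $(\delta,\pi-\delta)$. -/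

import Mathlib

noncomputable section

/-- The model surface `M²_κ` of constant curvature `κ`, as a set: the points
`(x 0, x 1, x 2)` of `ℝ³` with `(x 0)² + ε ((x 1)² + (x 2)²) = 1`, where `ε` is the sign of `κ`,
and `0 < x 0` when `κ ≤ 0`. This is the unit sphere for `κ > 0`, the Euclidean plane
`x 0 = 1` for `κ = 0`, and the upper sheet of the unit hyperboloid for `κ < 0`.
The curvature is made equal to `κ` by the scaling factor in `ModelPlane.dist`. -/
@[ext]
structure ModelPlane (κ : ℝ) where
  /-- the coordinates in `ℝ³` -/
  coords : Fin 3 → ℝ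
  equation : coords 0 ^ 2 + Real.sign κ * (coords 1 ^ 2 + coords 2 ^ 2) = 1
  positive : κ ≤ 0 → 0 < coords 0

namespace ModelPlane

/-- The form `x₀ y₀ + ε (x₁ y₁ + x₂ y₂)`, with `ε` the sign of `κ`. On points it is the cosine of
the angle between them for `κ > 0`, it is `1` for `κ = 0`, and it is minus the Minkowski product
for `κ < 0`. -/
def form (κ : ℝ) (x y : Fin 3 → ℝ) : ℝ :=
  x 0 * y 0 + Real.sign κ * (x 1 * y 1 + x 2 * y 2)

/-- The ambient form `u₁ w₁ + u₂ w₂ + ε u₀ w₀` (Euclidean on `ℝ³` for `κ > 0`, Minkowski for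
`κ < 0`, the inner product of the plane for `κ = 0`). Its restriction to the tangent planes of
the surface is, up to the constant scaling factor, the Riemannian metric. -/
def tangentInner (κ : ℝ) (u w : Fin 3 → ℝ) : ℝ :=
  u 1 * w 1 + u 2 * w 2 + Real.sign κ * (u 0 * w 0)

/-- The geodesic distance of `M²_κ`: the spherical distance divided by `√κ`, the Euclidean
distance, or the hyperbolic distance divided by `√(-κ)`. -/
def dist {κ : ℝ} (p q : ModelPlane κ) : ℝ :=
  if 0 < κ then Real.arccos (form κ p.coords q.coords) / √κ
  else if κ = 0 then
    √((p.coords 1 - q.coords 1) ^ 2 + (p.coords 2 - q.coords 2) ^ 2)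
  else Real.arcosh (form κ p.coords q.coords) / √(-κ)

/-- `m` is a midpoint of a minimal geodesic segment from `p` to `q`. -/
def IsMidpoint {κ : ℝ} (p q m : ModelPlane κ) : Prop :=
  dist p m = dist p q / 2 ∧ dist m q = dist p q / 2

/-- A tangent vector at `p` in the initial direction of the minimal geodesic segment from `p` to
`q`: the projection of `q` to the tangent plane at `p`. For a unit tangent vector `u` the geodesic
with initial vector `u` is `cos t • p + sin t • u`, `p + t • u` or `cosh t • p + sinh t • u`
(according to the sign of `κ`), and the projection of its point at time `t` is
`sin t • u`, `t • u` or `sinh t • u`. -/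
def direction {κ : ℝ} (p q : ModelPlane κ) : Fin 3 → ℝ :=
  q.coords - form κ p.coords q.coords • p.coords

/-- The angle at `p` between the geodesic segments from `p` to `q` and from `p` to `r`. -/
def angle {κ : ℝ} (q p r : ModelPlane κ) : ℝ :=
  Real.arccos (tangentInner κ (direction p q) (direction p r) /
    (√(tangentInner κ (direction p q) (direction p q)) *
      √(tangentInner κ (direction p r) (direction p r))))

set_option maxHeartbeats 1000000 in
/-- Every two points have a midpoint (so the subdivisions below are never empty). -/
theorem exists_isMidpoint {κ : ℝ} (p q : ModelPlane κ) : ∃ m, IsMidpoint p q m := by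
  obtain ⟨x, hx, hx0⟩ := p
  obtain ⟨y, hy, hy0⟩ := q
  rcases lt_trichotomy κ 0 with h | h | h
  · have hn : ¬ 0 < κ := by linarith
    rw [Real.sign_of_neg h] at hx hy
    have hx0 := hx0 h.le
    have hy0 := hy0 h.le
    set b := x 0 * y 0 - (x 1 * y 1 + x 2 * y 2) with hb
    have hb1 : 1 ≤ b := by
      have : x 1 * y 1 + x 2 * y 2 + 1 ≤ x 0 * y 0 := by
        refine le_of_abs_le (abs_le_of_sq_le_sq ?_ (by positivity))
        have e : (x 0 * y 0) ^ 2 = (1 + (x 1 ^ 2 + x 2 ^ 2)) * (1 + (y 1 ^ 2 + y 2 ^ 2)) := by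
          rw [mul_pow]; congr 1 <;> linarith
        rw [e]
        nlinarith [sq_nonneg (x 1 - y 1), sq_nonneg (x 2 - y 2),
          sq_nonneg (x 1 * y 2 - x 2 * y 1)]
      linarith
    set t := √(2 + 2 * b) with ht
    have htp : 0 < t := Real.sqrt_pos.2 (by linarith)
    have ht2 : t ^ 2 = 2 + 2 * b := Real.sq_sqrt (by linarith)
    have hc : Real.cosh (Real.arcosh b / 2) = t / 2 := by
      have h1 := Real.cosh_two_mul (Real.arcosh b / 2)
      have h2 := Real.cosh_sq (Real.arcosh b / 2)
      rw [mul_div_cancel₀ _ two_ne_zero, Real.cosh_arcosh hb1] at h1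
      have h3 := Real.cosh_pos (Real.arcosh b / 2)
      nlinarith
    have ha : Real.arcosh (t / 2) = Real.arcosh b / 2 := by
      rw [← hc, Real.arcosh_cosh (by linarith [Real.arcosh_nonneg hb1])]
    refine ⟨⟨fun i => (x i + y i) / t, ?_, fun _ => by positivity⟩, ?_, ?_⟩
    · rw [Real.sign_of_neg h]
      field_simp
      nlinarith
    · simp only [dist, hn, h.ne, if_false, form, Real.sign_of_neg h]
      rw [show x 0 * ((x 0 + y 0) / t) + -1 * (x 1 * ((x 1 + y 1) / t) + x 2 * ((x 2 + y 2) / t))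
        = t / 2 by field_simp; nlinarith, ha, hb, neg_one_mul, ← sub_eq_add_neg]
      ring
    · simp only [dist, hn, h.ne, if_false, form, Real.sign_of_neg h]
      rw [show (x 0 + y 0) / t * y 0 + -1 * ((x 1 + y 1) / t * y 1 + (x 2 + y 2) / t * y 2)
        = t / 2 by field_simp; nlinarith, ha, hb, neg_one_mul, ← sub_eq_add_neg]
      ring
  · subst h
    simp only [Real.sign_zero, zero_mul, add_zero] at hx hy
    refine ⟨⟨fun i => (x i + y i) / 2, ?_, fun _ => ?_⟩, ?_, ?_⟩
    · have := hx0 le_rfl; have := hy0 le_rfl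
      have h1 : x 0 = 1 := by nlinarith
      have h2 : y 0 = 1 := by nlinarith
      simp [h1, h2]
    · have := hx0 le_rfl; have := hy0 le_rfl
      positivity
    · simp only [dist, lt_irrefl, if_false, if_true]
      rw [show (x 1 - (x 1 + y 1) / 2) ^ 2 + (x 2 - (x 2 + y 2) / 2) ^ 2
        = ((x 1 - y 1) ^ 2 + (x 2 - y 2) ^ 2) / 2 ^ 2 by ring, Real.sqrt_div' _ (by positivity),
        Real.sqrt_sq (by norm_num)]
    · simp only [dist, lt_irrefl, if_false, if_true]
      rw [show ((x 1 + y 1) / 2 - y 1) ^ 2 + ((x 2 + y 2) / 2 - y 2) ^ 2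
        = ((x 1 - y 1) ^ 2 + (x 2 - y 2) ^ 2) / 2 ^ 2 by ring, Real.sqrt_div' _ (by positivity),
        Real.sqrt_sq (by norm_num)]
  · rw [Real.sign_of_pos h, one_mul] at hx hy
    set b := x 0 * y 0 + (x 1 * y 1 + x 2 * y 2) with hb
    have hb1 : b ≤ 1 := by
      nlinarith [sq_nonneg (x 0 - y 0), sq_nonneg (x 1 - y 1), sq_nonneg (x 2 - y 2)]
    have hb2 : -1 ≤ b := by
      nlinarith [sq_nonneg (x 0 + y 0), sq_nonneg (x 1 + y 1), sq_nonneg (x 2 + y 2)]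
    -- it suffices to find a unit vector whose products with both points are the half-angle cosine
    suffices H : ∃ z : Fin 3 → ℝ, z 0 ^ 2 + (z 1 ^ 2 + z 2 ^ 2) = 1 ∧
        x 0 * z 0 + (x 1 * z 1 + x 2 * z 2) = √((1 + b) / 2) ∧
        z 0 * y 0 + (z 1 * y 1 + z 2 * y 2) = √((1 + b) / 2) by
      obtain ⟨z, hz, h1, h2⟩ := H
      have ha : Real.arccos (√((1 + b) / 2)) = Real.arccos b / 2 := by
        have h3 := Real.cos_half (x := Real.arccos b)
          (by linarith [Real.arccos_nonneg b, Real.pi_pos]) (Real.arccos_le_pi b)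
        rw [Real.cos_arccos hb2 hb1] at h3
        rw [← h3, Real.arccos_cos (by linarith [Real.arccos_nonneg b])
          (by linarith [Real.arccos_le_pi b, Real.pi_pos])]
      refine ⟨⟨z, by rw [Real.sign_of_pos h, one_mul, hz], fun h' => by linarith⟩, ?_, ?_⟩
      · simp only [dist, h, if_true, form, Real.sign_of_pos h, one_mul]
        rw [h1, ha, hb]; ring
      · simp only [dist, h, if_true, form, Real.sign_of_pos h, one_mul]
        rw [h2, ha, hb]; ring
    rcases hb2.eq_or_lt with hb3 | hb3
    · have e0 : y 0 = - x 0 := by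
        nlinarith [sq_nonneg (x 0 + y 0), sq_nonneg (x 1 + y 1), sq_nonneg (x 2 + y 2)]
      have e1 : y 1 = - x 1 := by
        nlinarith [sq_nonneg (x 0 + y 0), sq_nonneg (x 1 + y 1), sq_nonneg (x 2 + y 2)]
      have e2 : y 2 = - x 2 := by
        nlinarith [sq_nonneg (x 0 + y 0), sq_nonneg (x 1 + y 1), sq_nonneg (x 2 + y 2)]
      rw [← hb3, e0, e1, e2]
      by_cases h0 : x 0 ^ 2 + x 1 ^ 2 = 0
      · have f0 : x 0 = 0 := by nlinarith [sq_nonneg (x 0), sq_nonneg (x 1)]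
        exact ⟨![1, 0, 0], by simp [f0]⟩
      · have hp : 0 < x 0 ^ 2 + x 1 ^ 2 := lt_of_le_of_ne (by positivity) (Ne.symm h0)
        have hs := Real.sq_sqrt hp.le
        have hs0 := Real.sqrt_pos.2 hp
        set s := √(x 0 ^ 2 + x 1 ^ 2)
        refine ⟨![- x 1 / s, x 0 / s, 0], ?_, ?_, ?_⟩
        · simp; field_simp; linarith
        · simp; ring
        · simp; ring
    · set t := √(2 + 2 * b) with ht
      have htp : 0 < t := Real.sqrt_pos.2 (by linarith)
      have ht2 : t ^ 2 = 2 + 2 * b := Real.sq_sqrt (by linarith)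
      have hs : √((1 + b) / 2) = t / 2 := by
        rw [show (1 + b) / 2 = (t / 2) ^ 2 by nlinarith, Real.sqrt_sq (by positivity)]
      rw [hs]
      refine ⟨fun i => (x i + y i) / t, ?_, ?_, ?_⟩
      · field_simp; nlinarith
      · field_simp; nlinarith
      · field_simp; nlinarith

end ModelPlane

/-- A triple of points of `M²_κ`; in the situations considered here it determines the three
minimal geodesic segments that form the sides. -/
@[ext]
structure GeodesicTriangle (κ : ℝ) where
  A : ModelPlane κ
  B : ModelPlane κ
  C : ModelPlane κ

namespace GeodesicTriangle

open ModelPlane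

/-- The vertices do not lie on a common geodesic line. The geodesic lines (great circles, straight
lines, hyperbolic lines) are the nonempty sections of the surface by planes of `ℝ³` through the
origin (other than `x 0 = 0` for `κ ≤ 0`, which misses the surface). -/
def IsNondegenerate {κ : ℝ} (T : GeodesicTriangle κ) : Prop :=
  LinearIndependent ℝ ![T.A.coords, T.B.coords, T.C.coords]

/-- The vertices lie in a common open hemisphere (meaningful for `κ > 0`): the open ball of radius
`π / (2√κ)` around some point. -/
def InOpenHemisphere {κ : ℝ} (T : GeodesicTriangle κ) : Prop :=
  ∃ c : ModelPlane κ, dist c T.A < Real.pi / (2 * √κ) ∧ dist c T.B < Real.pi / (2 * √κ) ∧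
    dist c T.C < Real.pi / (2 * √κ)

/-- `t` is one of the four triangles into which `T` is cut by joining the midpoints
`X`, `Y`, `Z` of its sides `BC`, `CA`, `AB`. -/
def IsMedialPart {κ : ℝ} (T t : GeodesicTriangle κ) : Prop :=
  ∃ X Y Z : ModelPlane κ, IsMidpoint T.B T.C X ∧ IsMidpoint T.C T.A Y ∧ IsMidpoint T.A T.B Z ∧
    (t = ⟨T.A, Z, Y⟩ ∨ t = ⟨Z, T.B, X⟩ ∨ t = ⟨Y, X, T.C⟩ ∨ t = ⟨X, Y, Z⟩)

/-- The set of triangles of the `n`-th iterated medial subdivision `T_n` of `T`. -/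
def subdivision {κ : ℝ} (T : GeodesicTriangle κ) : ℕ → Set (GeodesicTriangle κ)
  | 0 => {T}
  | n + 1 => {t | ∃ s ∈ subdivision T n, IsMedialPart s t}

/-- `θ` is one of the three interior angles of `t`. -/
def HasAngle {κ : ℝ} (t : GeodesicTriangle κ) (θ : ℝ) : Prop :=
  θ = angle t.B t.A t.C ∨ θ = angle t.C t.B t.A ∨ θ = angle t.A t.C t.B

end GeodesicTriangle

end

/-!
The central projection of the surface from the origin to an affine plane of `ℝ³` (the gnomonic
projection, or Beltrami–Klein model) maps geodesics to straight segments. The midpoint of `p` and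
`q` is a multiple of `p + q`, so in the plane it divides the segment between the images with
weights whose ratio tends to `1` linearly in the length of the segment. In a triangle whose sides
have length at most `d` all these weights are at least some `m = 1 / (2 + K d)`, so one subdivision
multiplies the bound on the sides by `1 - m` and areas by at least `2 m³`. Up to factors `1 + O(d)`
these are `1 / 2` and `1 / 4`; as `d` decreases geometrically, the product of the error factors
converges and the ratio of the area to the square of the longest side stays bounded below. This
ratio bounds the sines of the angles of the triangle on the surface from below.
-/

open scoped Matrix

section Segment

variable {E : Type*} [SeminormedAddCommGroup E] [NormedSpace ℝ E] {m d : ℝ} {x y z v w : E}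

/-- The points of the segment from `x` to `y` at which both barycentric weights are at least `m`. -/
def middleSegment (m : ℝ) (x y : E) : Set E :=
  AffineMap.lineMap x y '' Set.Icc m (1 - m)

theorem middleSegment_symm (m : ℝ) (x y : E) : middleSegment m x y = middleSegment m y x := by
  suffices h : ∀ x y : E, middleSegment m x y ⊆ middleSegment m y x from (h x y).antisymm (h y x)
  rintro x y _ ⟨l, ⟨hl, hl'⟩, rfl⟩
  exact ⟨1 - l, ⟨by linarith, by linarith⟩, AffineMap.lineMap_apply_one_sub _ _ _⟩

theorem norm_sub_le_of_mem_middleSegment (hm : 0 ≤ m) (hv : v ∈ middleSegment m x y)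
    (hxy : ‖x - y‖ ≤ d) : ‖x - v‖ ≤ (1 - m) * d := by
  obtain ⟨l, ⟨hl, hl'⟩, rfl⟩ := hv
  have hl0 : 0 ≤ l := hm.trans hl
  calc ‖x - AffineMap.lineMap x y l‖ = l * ‖x - y‖ := by
        rw [← dist_eq_norm, dist_left_lineMap, Real.norm_of_nonneg hl0, dist_eq_norm]
    _ ≤ (1 - m) * d := mul_le_mul hl' hxy (norm_nonneg _) (hl0.trans hl')

theorem norm_lineMap_sub_lineMap_le {s t : ℝ} (hs : 0 ≤ s) (hst : s ≤ t) (hxz : ‖x - z‖ ≤ d)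
    (hyz : ‖y - z‖ ≤ d) : ‖AffineMap.lineMap x y s - AffineMap.lineMap x z t‖ ≤ t * d := by
  have hdecomp : AffineMap.lineMap x y s - AffineMap.lineMap x z t =
      s • (y - z) + (t - s) • (x - z) := by
    simp only [AffineMap.lineMap_apply_module]
    module
  have hts : 0 ≤ t - s := sub_nonneg.2 hst
  calc ‖AffineMap.lineMap x y s - AffineMap.lineMap x z t‖
      ≤ s * ‖y - z‖ + (t - s) * ‖x - z‖ := by
        rw [hdecomp]
        refine (norm_add_le _ _).trans_eq ?_
        rw [norm_smul, norm_smul, Real.norm_of_nonneg hs, Real.norm_of_nonneg hts]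
    _ ≤ s * d + (t - s) * d := by gcongr
    _ = t * d := by ring

theorem norm_sub_le_of_mem_middleSegment_of_mem_middleSegment (hm : 0 ≤ m)
    (hv : v ∈ middleSegment m x y) (hw : w ∈ middleSegment m x z) (hxy : ‖x - y‖ ≤ d)
    (hxz : ‖x - z‖ ≤ d) (hyz : ‖y - z‖ ≤ d) : ‖v - w‖ ≤ (1 - m) * d := by
  have hd : 0 ≤ d := (norm_nonneg _).trans hxy
  obtain ⟨s, ⟨hs, hs'⟩, rfl⟩ := hv
  obtain ⟨t, ⟨ht, ht'⟩, rfl⟩ := hw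
  rcases le_total s t with hst | hts
  · exact (norm_lineMap_sub_lineMap_le (hm.trans hs) hst hxz hyz).trans (by gcongr)
  · rw [norm_sub_rev] at hyz ⊢
    exact (norm_lineMap_sub_lineMap_le (hm.trans ht) hts hxy hyz).trans (by gcongr)

end Segment

section TripleProduct

variable {R : Type*} [CommRing R]

theorem triple_product_lineMap_corner (x y z : Fin 3 → R) (s t : R) :
    x ⬝ᵥ AffineMap.lineMap x y s ⨯₃ AffineMap.lineMap x z t = s * t * (x ⬝ᵥ y ⨯₃ z) := by
  simp only [AffineMap.lineMap_apply_module, cross_apply, Matrix.vec3_dotProduct,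
    Matrix.cons_val, Pi.add_apply, Pi.smul_apply, smul_eq_mul]
  ring

theorem triple_product_lineMap_center (x y z : Fin 3 → R) (r s t : R) :
    AffineMap.lineMap y z r ⬝ᵥ AffineMap.lineMap z x s ⨯₃ AffineMap.lineMap x y t =
      ((1 - r) * (1 - s) * (1 - t) + r * s * t) * (x ⬝ᵥ y ⨯₃ z) := by
  simp only [AffineMap.lineMap_apply_module, cross_apply, Matrix.vec3_dotProduct,
    Matrix.cons_val, Pi.add_apply, Pi.smul_apply, smul_eq_mul]
  ring

theorem triple_product_ne_zero {x y z : Fin 3 → ℝ} (h : LinearIndependent ℝ ![x, y, z]) :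
    x ⬝ᵥ y ⨯₃ z ≠ 0 := by
  rw [triple_product_eq_det, ← isUnit_iff_ne_zero]
  exact (Matrix.isUnit_iff_isUnit_det _).1 (Matrix.linearIndependent_rows_iff_isUnit.1 h)

theorem norm_cross_le (x y : Fin 3 → ℝ) : ‖x ⨯₃ y‖ ≤ 2 * (‖x‖ * ‖y‖) := by
  have hsub (i j k l : Fin 3) : ‖x i * y j - x k * y l‖ ≤ 2 * (‖x‖ * ‖y‖) :=
    calc ‖x i * y j - x k * y l‖ ≤ ‖x i‖ * ‖y j‖ + ‖x k‖ * ‖y l‖ := by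
          simpa only [norm_mul] using norm_sub_le (x i * y j) (x k * y l)
      _ ≤ ‖x‖ * ‖y‖ + ‖x‖ * ‖y‖ := by gcongr <;> exact norm_le_pi_norm _ _
      _ = 2 * (‖x‖ * ‖y‖) := by ring
  refine (pi_norm_le_iff_of_nonneg (by positivity)).2 fun i => ?_
  fin_cases i <;> exact hsub _ _ _ _

end TripleProduct

/-- The sides of the triangle `x y z` of an affine plane of `ℝ³` that avoids the origin have length
at most `d`, and its area, measured by the volume of the parallelepiped spanned by the vertices, is
at least `s`. -/
structure ShapeBound (d s : ℝ) (x y z : Fin 3 → ℝ) : Prop where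
  norm_sub_le₁ : ‖x - y‖ ≤ d
  norm_sub_le₂ : ‖y - z‖ ≤ d
  norm_sub_le₃ : ‖z - x‖ ≤ d
  le_area : s ≤ |x ⬝ᵥ y ⨯₃ z|

namespace ShapeBound

variable {m d s s' : ℝ} {x y z u v w : Fin 3 → ℝ}

theorem mono (h : ShapeBound d s x y z) (hs : s' ≤ s) : ShapeBound d s' x y z :=
  { h with le_area := hs.trans h.le_area }

theorem rotate (h : ShapeBound d s x y z) : ShapeBound d s y z x :=
  ⟨h.norm_sub_le₂, h.norm_sub_le₃, h.norm_sub_le₁, triple_product_permutation x y z ▸ h.le_area⟩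

theorem corner (hm : 0 ≤ m) (h : ShapeBound d s x y z) (hv : v ∈ middleSegment m x y)
    (hw : w ∈ middleSegment m x z) : ShapeBound ((1 - m) * d) (2 * m ^ 3 * s) x v w := by
  obtain ⟨hxy, hyz, hzx, hs⟩ := h
  have hxz : ‖x - z‖ ≤ d := norm_sub_rev z x ▸ hzx
  refine ⟨norm_sub_le_of_mem_middleSegment hm hv hxy,
    norm_sub_le_of_mem_middleSegment_of_mem_middleSegment hm hv hw hxy hxz hyz,
    norm_sub_rev x w ▸ norm_sub_le_of_mem_middleSegment hm hw hxz, ?_⟩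
  obtain ⟨k, ⟨hk, hk'⟩, rfl⟩ := hv
  obtain ⟨l, ⟨hl, -⟩, rfl⟩ := hw
  have hkl : 2 * m ^ 3 ≤ k * l :=
    calc 2 * m ^ 3 = 2 * m * (m * m) := by ring
      _ ≤ 1 * (k * l) := by gcongr <;> linarith
      _ = k * l := one_mul _
  rw [triple_product_lineMap_corner, abs_mul, abs_of_nonneg (le_trans (by positivity) hkl)]
  exact (mul_le_mul_of_nonneg_left hs (by positivity)).trans
    (mul_le_mul_of_nonneg_right hkl (abs_nonneg _))

theorem center (hm : 0 ≤ m) (h : ShapeBound d s x y z) (hu : u ∈ middleSegment m y z)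
    (hv : v ∈ middleSegment m z x) (hw : w ∈ middleSegment m x y) :
    ShapeBound ((1 - m) * d) (2 * m ^ 3 * s) u v w := by
  obtain ⟨hxy, hyz, hzx, hs⟩ := h
  have side {x y z v w : Fin 3 → ℝ} (hv : v ∈ middleSegment m x y) (hw : w ∈ middleSegment m z x)
      (hxy : ‖x - y‖ ≤ d) (hyz : ‖y - z‖ ≤ d) (hzx : ‖z - x‖ ≤ d) : ‖w - v‖ ≤ (1 - m) * d := by
    rw [middleSegment_symm] at hw
    rw [norm_sub_rev] at hyz hzx
    exact norm_sub_le_of_mem_middleSegment_of_mem_middleSegment hm hw hv hzx hxy hyz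
  refine ⟨side hv hu hzx hxy hyz, side hw hv hxy hyz hzx, side hu hw hyz hzx hxy, ?_⟩
  obtain ⟨i, ⟨hi, hi'⟩, rfl⟩ := hu
  obtain ⟨j, ⟨hj, hj'⟩, rfl⟩ := hv
  obtain ⟨k, ⟨hk, hk'⟩, rfl⟩ := hw
  have cube_le {a b c : ℝ} (ha : m ≤ a) (hb : m ≤ b) (hc : m ≤ c) : m * m * m ≤ a * b * c :=
    have ha0 : 0 ≤ a := hm.trans ha
    mul_le_mul (mul_le_mul ha hb hm ha0) hc hm (mul_nonneg ha0 (hm.trans hb))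
  have hcoef : 2 * m ^ 3 ≤ (1 - i) * (1 - j) * (1 - k) + i * j * k := by
    linear_combination cube_le hi hj hk +
      cube_le (le_sub_comm.1 hi') (le_sub_comm.1 hj') (le_sub_comm.1 hk')
  rw [triple_product_lineMap_center, abs_mul, abs_of_nonneg (le_trans (by positivity) hcoef)]
  exact (mul_le_mul_of_nonneg_left hs (by positivity)).trans
    (mul_le_mul_of_nonneg_right hcoef (abs_nonneg _))

end ShapeBound

/-- The lower bound for the area of a triangle with sides at most `d` that subdivision preserves.
The factor `exp (L * d)` absorbs the deviation of the subdivision from the Euclidean one, since `d`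
decreases geometrically. -/
noncomputable def areaBound (c L d : ℝ) : ℝ :=
  c * d ^ 2 * Real.exp (L * d)

theorem areaBound_sub_mul_le {c K L d d₀ : ℝ} (hc : 0 ≤ c) (hK : 0 ≤ K) (hd : 0 ≤ d)
    (hd₀ : d ≤ d₀) (hL : 3 * K * (2 + K * d₀) ≤ L) :
    areaBound c L ((1 - (2 + K * d)⁻¹) * d) ≤ 2 * (2 + K * d)⁻¹ ^ 3 * areaBound c L d := by
  set u := K * d
  have hu0 : 0 ≤ u := by positivity
  have hu_le : u ≤ K * d₀ := mul_le_mul_of_nonneg_left hd₀ hK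
  set m := (2 + u)⁻¹
  have : 0 < m := by positivity
  have hm1 : m * (2 + u) = 1 := inv_mul_cancel₀ (by positivity)
  have hfactor : 1 - m = m * (1 + u) := by linarith
  have hexponent : 3 * u ≤ L * (m * d) :=
    calc 3 * u = 3 * K * (2 + u) * (m * d) := by linear_combination (-3 * K * d) * hm1
      _ ≤ 3 * K * (2 + K * d₀) * (m * d) := by gcongr
      _ ≤ L * (m * d) := by gcongr
  have hexp : (1 + u) ^ 2 * (1 + u / 2) ≤ Real.exp (L * (m * d)) :=
    calc (1 + u) ^ 2 * (1 + u / 2) ≤ (1 + u) ^ 2 * (1 + u) := by gcongr; linarith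
      _ = (u + 1) ^ 3 := by ring
      _ ≤ Real.exp u ^ 3 := by gcongr; exact Real.add_one_le_exp u
      _ = Real.exp (3 * u) := by rw [← Real.exp_nat_mul]; norm_num
      _ ≤ Real.exp (L * (m * d)) := Real.exp_le_exp.2 hexponent
  have hsplit : Real.exp (L * ((1 - m) * d)) * Real.exp (L * (m * d)) = Real.exp (L * d) := by
    rw [← Real.exp_add]
    ring_nf
  set e := Real.exp (L * ((1 - m) * d))
  have : 0 < e := Real.exp_pos _
  calc areaBound c L ((1 - m) * d) = c * ((1 - m) * d) ^ 2 * e := rfl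
    _ = 2 * m ^ 3 * (c * d ^ 2 * (e * ((1 + u) ^ 2 * (1 + u / 2)))) := by
        rw [hfactor]
        linear_combination (-c * (m * (1 + u) * d) ^ 2 * e) * hm1
    _ ≤ 2 * m ^ 3 * (c * d ^ 2 * (e * Real.exp (L * (m * d)))) := by gcongr
    _ = 2 * m ^ 3 * areaBound c L d := by rw [hsplit, areaBound]

theorem mul_sq_le_areaBound {c L d : ℝ} (hc : 0 ≤ c) (hL : 0 ≤ L) (hd : 0 ≤ d) :
    c * d ^ 2 ≤ areaBound c L d :=
  le_mul_of_one_le_right (by positivity) (Real.one_le_exp (by positivity))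

theorem one_sub_inv_mul_mem_Ioc {K d d₀ : ℝ} (hK : 0 ≤ K) (hd : d ∈ Set.Ioc 0 d₀) :
    (1 - (2 + K * d)⁻¹) * d ∈ Set.Ioc 0 d₀ := by
  obtain ⟨hd0, hd⟩ := hd
  have hpos : 0 < (2 + K * d)⁻¹ := by positivity
  have hlt : (2 + K * d)⁻¹ < 1 := inv_lt_one_of_one_lt₀ (by linarith [mul_nonneg hK hd0.le])
  exact ⟨mul_pos (by linarith) hd0, (mul_le_of_le_one_left hd0.le (by linarith)).trans hd⟩

namespace ModelPlane

variable {κ : ℝ} {o p q r m : ModelPlane κ} {H R d : ℝ}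

theorem form_comm (κ : ℝ) (x y : Fin 3 → ℝ) : form κ x y = form κ y x := by
  simp only [form]
  ring

theorem form_add_right (κ : ℝ) (x y z : Fin 3 → ℝ) :
    form κ x (y + z) = form κ x y + form κ x z := by
  simp only [form, Pi.add_apply]
  ring

theorem form_smul_right (κ a : ℝ) (x y : Fin 3 → ℝ) : form κ x (a • y) = a * form κ x y := by
  simp only [form, Pi.smul_apply, smul_eq_mul]
  ring

theorem form_self (p : ModelPlane κ) : form κ p.coords p.coords = 1 :=
  .trans (by simp only [form]; ring) p.equation

theorem abs_sign_le_one (κ : ℝ) : |Real.sign κ| ≤ 1 := by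
  rcases Real.sign_apply_eq κ with h | h | h <;> norm_num [h]

theorem abs_apply_mul_apply_le (x y : Fin 3 → ℝ) (i : Fin 3) : |x i * y i| ≤ ‖x‖ * ‖y‖ := by
  rw [abs_mul]
  exact mul_le_mul (norm_le_pi_norm x i) (norm_le_pi_norm y i) (abs_nonneg _) (norm_nonneg _)

theorem abs_form_le (κ : ℝ) (x y : Fin 3 → ℝ) : |form κ x y| ≤ 3 * (‖x‖ * ‖y‖) :=
  calc |form κ x y| ≤ |x 0 * y 0| + |Real.sign κ * (x 1 * y 1 + x 2 * y 2)| := abs_add_le _ _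
    _ ≤ |x 0 * y 0| + |Real.sign κ| * (|x 1 * y 1| + |x 2 * y 2|) := by
        rw [abs_mul (Real.sign κ)]
        gcongr
        exact abs_add_le _ _
    _ ≤ ‖x‖ * ‖y‖ + 1 * (‖x‖ * ‖y‖ + ‖x‖ * ‖y‖) := by
        gcongr <;> first | exact abs_sign_le_one κ | exact abs_apply_mul_apply_le x y _
    _ = 3 * (‖x‖ * ‖y‖) := by ring

theorem tangentInner_self_le (κ : ℝ) (x : Fin 3 → ℝ) : tangentInner κ x x ≤ 3 * ‖x‖ ^ 2 :=
  calc tangentInner κ x x ≤ |x 1 * x 1| + |x 2 * x 2| + |Real.sign κ| * |x 0 * x 0| := by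
        rw [tangentInner, ← abs_mul]
        gcongr <;> exact le_abs_self _
    _ ≤ ‖x‖ * ‖x‖ + ‖x‖ * ‖x‖ + 1 * (‖x‖ * ‖x‖) := by
        gcongr <;> first | exact abs_sign_le_one κ | exact abs_apply_mul_apply_le x x _
    _ = 3 * ‖x‖ ^ 2 := by ring

theorem tangentInner_smul_self (κ a : ℝ) (x : Fin 3 → ℝ) :
    tangentInner κ (a • x) (a • x) = a ^ 2 * tangentInner κ x x := by
  simp only [tangentInner, Pi.smul_apply, smul_eq_mul]
  ring

theorem form_of_pos (h : 0 < κ) (x y : Fin 3 → ℝ) : form κ x y = x ⬝ᵥ y := by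
  rw [form, Real.sign_of_pos h, Matrix.vec3_dotProduct]
  ring

theorem form_le_one_of_pos (h : 0 < κ) (p q : ModelPlane κ) : form κ p.coords q.coords ≤ 1 := by
  have hp := form_self p
  have hq := form_self q
  have hsub := dotProduct_star_self_nonneg (p.coords - q.coords)
  simp only [form_of_pos h, star_trivial, sub_dotProduct, dotProduct_sub,
    dotProduct_comm q.coords p.coords] at hp hq hsub ⊢
  linarith

theorem neg_one_le_form_of_pos (h : 0 < κ) (p q : ModelPlane κ) :
    -1 ≤ form κ p.coords q.coords := by
  have hp := form_self p
  have hq := form_self q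
  have hadd := dotProduct_star_self_nonneg (p.coords + q.coords)
  simp only [form_of_pos h, star_trivial, add_dotProduct, dotProduct_add,
    dotProduct_comm q.coords p.coords] at hp hq hadd ⊢
  linarith

theorem coords_zero_eq_one (p : ModelPlane 0) : p.coords 0 = 1 := by
  have hp := p.equation
  rw [Real.sign_zero, zero_mul, add_zero] at hp
  exact (pow_eq_one_iff_of_nonneg (p.positive le_rfl).le two_ne_zero).1 hp

theorem form_zero (p q : ModelPlane 0) : form 0 p.coords q.coords = 1 := by
  rw [form, coords_zero_eq_one, coords_zero_eq_one, Real.sign_zero]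
  ring

/-- The reversed Cauchy–Schwarz inequality on the hyperboloid, with its defect. -/
theorem sq_coords_zero_mul_coords_zero (h : κ < 0) (p q : ModelPlane κ) :
    (p.coords 0 * q.coords 0) ^ 2 =
      (1 + (p.coords 1 * q.coords 1 + p.coords 2 * q.coords 2)) ^ 2 +
        ((p.coords 1 - q.coords 1) ^ 2 + (p.coords 2 - q.coords 2) ^ 2 +
          (p.coords 1 * q.coords 2 - p.coords 2 * q.coords 1) ^ 2) := by
  have hp := p.equation
  have hq := q.equation
  rw [Real.sign_of_neg h] at hp hq
  linear_combination (q.coords 0) ^ 2 * hp + (1 + p.coords 1 ^ 2 + p.coords 2 ^ 2) * hq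

theorem one_le_form_of_nonpos (h : κ ≤ 0) (p q : ModelPlane κ) :
    1 ≤ form κ p.coords q.coords := by
  rcases h.lt_or_eq with h | rfl
  · have hle : 1 + (p.coords 1 * q.coords 1 + p.coords 2 * q.coords 2) ≤
        p.coords 0 * q.coords 0 := by
      refine le_of_abs_le (abs_le_of_sq_le_sq ?_
        (mul_pos (p.positive h.le) (q.positive h.le)).le)
      rw [sq_coords_zero_mul_coords_zero h]
      exact le_add_of_nonneg_right (by positivity)
    rw [form, Real.sign_of_neg h]
    linarith
  · exact (form_zero p q).ge

theorem eq_of_form_eq_one (hκ : κ ≠ 0) (h : form κ p.coords q.coords = 1) : p = q := by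
  rcases hκ.lt_or_gt with hκ | hκ
  · have hdefect := sq_coords_zero_mul_coords_zero hκ p q
    rw [form, Real.sign_of_neg hκ] at h
    rw [show p.coords 0 * q.coords 0 = 1 + (p.coords 1 * q.coords 1 + p.coords 2 * q.coords 2) by
      linarith, left_eq_add] at hdefect
    have h₁ : p.coords 1 = q.coords 1 := by
      nlinarith [sq_nonneg (p.coords 1 - q.coords 1), sq_nonneg (p.coords 2 - q.coords 2),
        sq_nonneg (p.coords 1 * q.coords 2 - p.coords 2 * q.coords 1)]
    have h₂ : p.coords 2 = q.coords 2 := by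
      nlinarith [sq_nonneg (p.coords 1 - q.coords 1), sq_nonneg (p.coords 2 - q.coords 2),
        sq_nonneg (p.coords 1 * q.coords 2 - p.coords 2 * q.coords 1)]
    have h₀ : p.coords 0 = q.coords 0 := by
      have heq := p.equation.trans q.equation.symm
      rw [h₁, h₂, add_left_inj] at heq
      exact (pow_left_inj₀ (p.positive hκ.le).le (q.positive hκ.le).le two_ne_zero).1 heq
    ext i
    fin_cases i
    exacts [h₀, h₁, h₂]
  · have hp := form_self p
    have hq := form_self q
    rw [form_of_pos hκ] at h hp hq
    refine ModelPlane.ext (sub_eq_zero.1 (dotProduct_self_eq_zero.1 ?_))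
    rw [sub_dotProduct, dotProduct_sub, dotProduct_sub, hp, hq, dotProduct_comm q.coords, h]
    norm_num

theorem neg_one_lt_form (hp : 0 < form κ o.coords p.coords) (hq : 0 < form κ o.coords q.coords) :
    -1 < form κ p.coords q.coords := by
  rcases le_or_gt κ 0 with hκ | hκ
  · linarith [one_le_form_of_nonpos hκ p q]
  · refine (neg_one_le_form_of_pos hκ p q).lt_of_ne fun h => ?_
    rw [form_of_pos hκ] at h hp hq
    have hsum : p.coords + q.coords = 0 := by
      rw [← dotProduct_self_eq_zero, add_dotProduct, dotProduct_add, dotProduct_add,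
        dotProduct_comm q.coords p.coords, ← h, ← form_of_pos hκ, ← form_of_pos hκ, form_self,
        form_self]
      norm_num
    have : o.coords ⬝ᵥ (p.coords + q.coords) = 0 := by rw [hsum, dotProduct_zero]
    rw [dotProduct_add] at this
    linarith

theorem form_eq_of_dist_eq_half (hκ : κ ≠ 0) {p' q' : ModelPlane κ}
    (h : dist p' q' = dist p q / 2) :
    form κ p'.coords q'.coords = √(2 + 2 * form κ p.coords q.coords) / 2 := by
  set f := form κ p.coords q.coords with hf
  set f' := form κ p'.coords q'.coords with hf'
  suffices H : 0 ≤ f' ∧ f = 2 * f' ^ 2 - 1 by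
    rw [H.2, show 2 + 2 * (2 * f' ^ 2 - 1) = (2 * f') ^ 2 by ring,
      Real.sqrt_sq (mul_nonneg zero_le_two H.1), mul_div_cancel_left₀ _ two_ne_zero]
  rcases hκ.lt_or_gt with hκ | hκ
  · have h1 : 1 ≤ f := one_le_form_of_nonpos hκ.le p q
    have h1' : 1 ≤ f' := one_le_form_of_nonpos hκ.le p' q'
    have hs : √(-κ) ≠ 0 := (Real.sqrt_pos.2 (neg_pos.2 hκ)).ne'
    have harcosh : Real.arcosh f = 2 * Real.arcosh f' := by
      simp only [dist, hκ.not_gt, hκ.ne, if_false, ← hf, ← hf'] at h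
      field_simp at h
      linarith
    refine ⟨by linarith, ?_⟩
    rw [← Real.cosh_arcosh h1, harcosh, Real.cosh_two_mul, Real.sinh_sq, Real.cosh_arcosh h1']
    ring
  · have hs : √κ ≠ 0 := (Real.sqrt_pos.2 hκ).ne'
    have harccos : Real.arccos f = 2 * Real.arccos f' := by
      simp only [dist, hκ, if_true, ← hf, ← hf'] at h
      field_simp at h
      linarith
    refine ⟨Real.arccos_le_pi_div_two.1 (by linarith [Real.arccos_le_pi f]), ?_⟩
    have h1 : Real.cos (Real.arccos f) = f :=
      Real.cos_arccos (neg_one_le_form_of_pos hκ p q) (form_le_one_of_pos hκ p q)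
    have h1' : Real.cos (Real.arccos f') = f' :=
      Real.cos_arccos (neg_one_le_form_of_pos hκ p' q') (form_le_one_of_pos hκ p' q')
    rw [← h1, harccos, Real.cos_two_mul, h1']

theorem sq_dist_zero (p q : ModelPlane 0) :
    dist p q ^ 2 = (p.coords 1 - q.coords 1) ^ 2 + (p.coords 2 - q.coords 2) ^ 2 := by
  simp only [dist, lt_irrefl, if_false, if_true]
  exact Real.sq_sqrt (by positivity)

/-- The midpoint of the minimal geodesic segment between two points that are not antipodal. -/
noncomputable def midpoint (p q : ModelPlane κ) (hpq : -1 < form κ p.coords q.coords) :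
    ModelPlane κ where
  coords := (√(2 + 2 * form κ p.coords q.coords))⁻¹ • (p.coords + q.coords)
  equation := by
    have hp := form_self p
    have hq := form_self q
    have hsq : √(2 + 2 * form κ p.coords q.coords) ^ 2 = 2 + 2 * form κ p.coords q.coords :=
      Real.sq_sqrt (by linarith)
    have hinv : (√(2 + 2 * form κ p.coords q.coords))⁻¹ ^ 2 *
        (2 + 2 * form κ p.coords q.coords) = 1 := by
      rw [inv_pow, hsq, inv_mul_cancel₀ (by linarith)]
    rw [← hinv]
    simp only [form, Pi.smul_apply, Pi.add_apply, smul_eq_mul] at hp hq ⊢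
    linear_combination (√(2 + 2 * (p.coords 0 * q.coords 0 + Real.sign κ *
      (p.coords 1 * q.coords 1 + p.coords 2 * q.coords 2))))⁻¹ ^ 2 * (hp + hq)
  positive hκ := mul_pos (inv_pos.2 (Real.sqrt_pos.2 (by linarith)))
    (add_pos (p.positive hκ) (q.positive hκ))

theorem IsMidpoint.eq_midpoint (hm : IsMidpoint p q m)
    (hpq : -1 < form κ p.coords q.coords) : m = midpoint p q hpq := by
  rcases eq_or_ne κ 0 with rfl | hκ
  · obtain ⟨hpm, hmq⟩ := hm
    have hsum : (2 * m.coords 1 - p.coords 1 - q.coords 1) ^ 2 +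
        (2 * m.coords 2 - p.coords 2 - q.coords 2) ^ 2 = 0 := by
      have hpm2 := sq_dist_zero p m
      have hmq2 := sq_dist_zero m q
      rw [hpm] at hpm2
      rw [hmq] at hmq2
      linear_combination (-2) * hpm2 - 2 * hmq2 + sq_dist_zero p q
    have h₁ : 2 * m.coords 1 - p.coords 1 - q.coords 1 = 0 := by nlinarith
    have h₂ : 2 * m.coords 2 - p.coords 2 - q.coords 2 = 0 := by nlinarith
    have ht : √(2 + 2 * form 0 p.coords q.coords) = 2 := by
      rw [form_zero, Real.sqrt_eq_iff_mul_self_eq_of_pos two_pos]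
      norm_num
    ext i
    simp only [midpoint, ht, Pi.smul_apply, Pi.add_apply, smul_eq_mul]
    fin_cases i
    · norm_num [coords_zero_eq_one]
    · change m.coords 1 = 2⁻¹ * (p.coords 1 + q.coords 1)
      linarith
    · change m.coords 2 = 2⁻¹ * (p.coords 2 + q.coords 2)
      linarith
  · have ht : √(2 + 2 * form κ p.coords q.coords) ≠ 0 := by
      rw [Real.sqrt_ne_zero']
      linarith
    refine eq_of_form_eq_one hκ ?_
    rw [midpoint, form_smul_right, form_add_right, form_comm κ _ p.coords,
      form_eq_of_dist_eq_half hκ hm.1, form_eq_of_dist_eq_half hκ hm.2, add_halves,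
      inv_mul_cancel₀ ht]

theorem tangentInner_direction (p q r : ModelPlane κ) :
    tangentInner κ (direction p q) (direction p r) =
      tangentInner κ (p.coords ⨯₃ q.coords) (p.coords ⨯₃ r.coords) := by
  have hp := p.equation
  simp only [tangentInner, direction, form, cross_apply, Matrix.cons_val, Pi.sub_apply,
    Pi.smul_apply, smul_eq_mul]
  generalize p.coords = x at *
  generalize q.coords = y at *
  generalize r.coords = z at *
  rcases Real.sign_apply_eq κ with h | h | h <;> rw [h] at hp ⊢
  · linear_combination (-(x 0 * y 0 - (x 1 * y 1 + x 2 * y 2)) *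
      (x 0 * z 0 - (x 1 * z 1 + x 2 * z 2)) - (y 1 * z 1 + y 2 * z 2 - y 0 * z 0)) * hp
  · linear_combination ((x 1 ^ 2 + x 2 ^ 2) * y 0 * z 0 - (y 1 * z 1 + y 2 * z 2)) * hp
  · linear_combination ((x 0 * y 0 + (x 1 * y 1 + x 2 * y 2)) *
      (x 0 * z 0 + (x 1 * z 1 + x 2 * z 2)) - (y 1 * z 1 + y 2 * z 2 + y 0 * z 0)) * hp

theorem tangentInner_mul_sub_sq (κ : ℝ) (u v : Fin 3 → ℝ) :
    tangentInner κ u u * tangentInner κ v v - tangentInner κ u v ^ 2 =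
      form κ (u ⨯₃ v) (u ⨯₃ v) := by
  simp only [tangentInner, form, cross_apply, Matrix.cons_val]
  ring

theorem gram_direction (p q r : ModelPlane κ) :
    tangentInner κ (direction p q) (direction p q) *
        tangentInner κ (direction p r) (direction p r) -
      tangentInner κ (direction p q) (direction p r) ^ 2 =
    (p.coords ⬝ᵥ q.coords ⨯₃ r.coords) ^ 2 := by
  have hcross : (p.coords ⨯₃ q.coords) ⨯₃ (p.coords ⨯₃ r.coords) =
      (p.coords ⬝ᵥ q.coords ⨯₃ r.coords) • p.coords := by
    rw [cross_cross_eq_smul_sub_smul, dot_self_cross, zero_smul, zero_sub, ← neg_smul,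
      triple_product_permutation, ← cross_anticomm, dotProduct_neg, neg_neg]
  rw [tangentInner_direction, tangentInner_direction, tangentInner_direction,
    tangentInner_mul_sub_sq, hcross, form_smul_right, form_comm, form_smul_right, form_self]
  ring

theorem tangentInner_direction_self_nonneg (p q : ModelPlane κ) :
    0 ≤ tangentInner κ (direction p q) (direction p q) := by
  rcases lt_trichotomy κ 0 with hκ | rfl | hκ
  · have hpq := one_le_form_of_nonpos hκ.le p q
    have hp := p.equation
    have hq := q.equation
    calc 0 ≤ form κ p.coords q.coords ^ 2 - 1 := by nlinarith
      _ = tangentInner κ (direction p q) (direction p q) := by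
        rw [tangentInner_direction]
        simp only [form, tangentInner, cross_apply, Matrix.cons_val, Real.sign_of_neg hκ] at hp hq ⊢
        linear_combination (q.coords 0 ^ 2 - (q.coords 1 ^ 2 + q.coords 2 ^ 2)) * hp + hq
  · rw [tangentInner, Real.sign_zero, zero_mul, add_zero]
    exact add_nonneg (mul_self_nonneg _) (mul_self_nonneg _)
  · rw [tangentInner, Real.sign_of_pos hκ, one_mul]
    exact add_nonneg (add_nonneg (mul_self_nonneg _) (mul_self_nonneg _)) (mul_self_nonneg _)

theorem sqrt_mul_sqrt_mul_sin_angle (p q r : ModelPlane κ) :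
    √(tangentInner κ (direction p q) (direction p q)) *
        √(tangentInner κ (direction p r) (direction p r)) * Real.sin (angle q p r) =
      |p.coords ⬝ᵥ q.coords ⨯₃ r.coords| := by
  have hgram := gram_direction p q r
  have hq := Real.sq_sqrt (tangentInner_direction_self_nonneg p q)
  have hr := Real.sq_sqrt (tangentInner_direction_self_nonneg p r)
  rw [← hq, ← hr, ← mul_pow] at hgram
  rw [angle, Real.sin_arccos]
  set a := √(tangentInner κ (direction p q) (direction p q)) *
    √(tangentInner κ (direction p r) (direction p r))
  set i := tangentInner κ (direction p q) (direction p r)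
  have ha : 0 ≤ a := by positivity
  rcases ha.eq_or_lt with ha0 | hapos
  · have htriple : (p.coords ⬝ᵥ q.coords ⨯₃ r.coords) ^ 2 = 0 :=
      le_antisymm (by rw [← hgram, ← ha0]; linarith [sq_nonneg i]) (sq_nonneg _)
    rw [← ha0, zero_mul, pow_eq_zero_iff two_ne_zero |>.1 htriple, abs_zero]
  · calc a * √(1 - (i / a) ^ 2) = √(a ^ 2 * (1 - (i / a) ^ 2)) := by
          rw [Real.sqrt_mul (sq_nonneg a), Real.sqrt_sq ha]
      _ = √((p.coords ⬝ᵥ q.coords ⨯₃ r.coords) ^ 2) := by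
          rw [← hgram]
          field_simp
      _ = |p.coords ⬝ᵥ q.coords ⨯₃ r.coords| := Real.sqrt_sq_eq_abs _

/-- The gnomonic projection centred at `o`: the intersection of the line of `ℝ³` through the origin
and `p` with the plane through `o` on which `form κ o.coords` equals `1`. It is only meaningful if
`form κ o.coords p.coords ≠ 0`. -/
noncomputable def gnomonic (o p : ModelPlane κ) : Fin 3 → ℝ :=
  (form κ o.coords p.coords)⁻¹ • p.coords

/-- The points `p` for which the proportionality factor of `p` to its gnomonic projection centred
at `o` is positive and at most `H`, and the projection has norm at most `R`. -/
def gnomonicRegion (o : ModelPlane κ) (H R : ℝ) : Set (ModelPlane κ) :=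
  {p | 0 < form κ o.coords p.coords ∧ form κ o.coords p.coords ≤ H ∧ ‖gnomonic o p‖ ≤ R}

theorem smul_gnomonic (hp : 0 < form κ o.coords p.coords) :
    form κ o.coords p.coords • gnomonic o p = p.coords :=
  smul_inv_smul₀ hp.ne' _

theorem sq_mul_form_gnomonic_self (hp : 0 < form κ o.coords p.coords) :
    form κ o.coords p.coords ^ 2 * form κ (gnomonic o p) (gnomonic o p) = 1 := by
  have hself : form κ (form κ o.coords p.coords • gnomonic o p)
      (form κ o.coords p.coords • gnomonic o p) = 1 := by
    rw [smul_gnomonic hp, form_self]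
  rw [form_smul_right, form_comm κ _ (gnomonic o p), form_smul_right] at hself
  linear_combination hself

theorem form_le_mul_form_of_norm_sub_le (hp : p ∈ gnomonicRegion o H R)
    (hq : q ∈ gnomonicRegion o H R) (hpq : ‖gnomonic o p - gnomonic o q‖ ≤ d) :
    form κ o.coords p.coords ≤ (1 + 6 * R * H ^ 2 * d) * form κ o.coords q.coords := by
  obtain ⟨hp0, hpH, hpR⟩ := hp
  obtain ⟨hq0, -, hqR⟩ := hq
  have hR : 0 ≤ R := (norm_nonneg _).trans hpR
  have hd : 0 ≤ d := (norm_nonneg _).trans hpq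
  have hform_p := sq_mul_form_gnomonic_self hp0
  have hform_q := sq_mul_form_gnomonic_self hq0
  set a := gnomonic o p
  set b := gnomonic o q
  set s := form κ o.coords p.coords
  set t := form κ o.coords q.coords
  have hab : form κ b b - form κ a a ≤ 6 * R * d :=
    calc form κ b b - form κ a a = -form κ (a - b) (a + b) := by
          simp only [form, Pi.sub_apply, Pi.add_apply]
          ring
      _ ≤ 3 * (‖a - b‖ * ‖a + b‖) := (neg_le_abs _).trans (abs_form_le _ _ _)
      _ ≤ 3 * (d * (R + R)) := by
          gcongr
          exact norm_add_le_of_le hpR hqR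
      _ = 6 * R * d := by ring
  refine le_of_sq_le_sq ?_ (by positivity)
  calc s ^ 2 = s ^ 2 * form κ b b * t ^ 2 := by linear_combination (-s ^ 2) * hform_q
    _ ≤ s ^ 2 * (form κ a a + 6 * R * d) * t ^ 2 := by
        gcongr
        linarith
    _ = (1 + 6 * R * s ^ 2 * d) * t ^ 2 := by linear_combination t ^ 2 * hform_p
    _ ≤ (1 + 6 * R * H ^ 2 * d) * t ^ 2 := by gcongr
    _ ≤ (1 + 6 * R * H ^ 2 * d) ^ 2 * t ^ 2 := by
        gcongr
        exact le_self_pow₀ (le_add_of_nonneg_right (by positivity)) two_ne_zero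
    _ = ((1 + 6 * R * H ^ 2 * d) * t) ^ 2 := by ring

theorem form_midpoint (hpq : -1 < form κ p.coords q.coords) :
    form κ o.coords (midpoint p q hpq).coords = (√(2 + 2 * form κ p.coords q.coords))⁻¹ *
      (form κ o.coords p.coords + form κ o.coords q.coords) := by
  rw [midpoint, form_smul_right, form_add_right]

theorem gnomonic_midpoint (hp : 0 < form κ o.coords p.coords)
    (hq : 0 < form κ o.coords q.coords) (hpq : -1 < form κ p.coords q.coords) :
    gnomonic o (midpoint p q hpq) = AffineMap.lineMap (gnomonic o p) (gnomonic o q)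
      (form κ o.coords q.coords / (form κ o.coords p.coords + form κ o.coords q.coords)) := by
  have hc : √(2 + 2 * form κ p.coords q.coords) ≠ 0 := by
    rw [Real.sqrt_ne_zero']
    linarith
  simp only [gnomonic, form_midpoint, AffineMap.lineMap_apply_module, smul_smul]
  rw [midpoint, smul_smul, smul_add]
  generalize √(2 + 2 * form κ p.coords q.coords) = c at hc
  congr 2 <;> field_simp
  ring

theorem IsMidpoint.mem_gnomonicRegion (hm : IsMidpoint p q m) (hH : 1 ≤ H)
    (hp : p ∈ gnomonicRegion o H R) (hq : q ∈ gnomonicRegion o H R) :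
    m ∈ gnomonicRegion o H R := by
  have hpq := neg_one_lt_form hp.1 hq.1
  obtain rfl := hm.eq_midpoint hpq
  obtain ⟨hp0, hpH, hpR⟩ := hp
  obtain ⟨hq0, hqH, hqR⟩ := hq
  have ht : 0 < √(2 + 2 * form κ p.coords q.coords) := Real.sqrt_pos.2 (by linarith)
  refine ⟨?_, ?_, ?_⟩
  · rw [form_midpoint]
    positivity
  · rcases le_or_gt κ 0 with hκ | hκ
    · have h2 : 2 ≤ √(2 + 2 * form κ p.coords q.coords) :=
        Real.le_sqrt_of_sq_le (by linarith [one_le_form_of_nonpos hκ p q])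
      rw [form_midpoint, inv_mul_le_iff₀ ht]
      nlinarith
    · exact (form_le_one_of_pos hκ _ _).trans hH
  · rw [gnomonic_midpoint hp0 hq0, ← mem_closedBall_zero_iff]
    refine (convex_closedBall _ _).lineMap_mem (mem_closedBall_zero_iff.2 hpR)
      (mem_closedBall_zero_iff.2 hqR) ⟨by positivity, ?_⟩
    rw [div_le_one (by positivity)]
    linarith

theorem IsMidpoint.gnomonic_mem_middleSegment (hm : IsMidpoint p q m)
    (hp : p ∈ gnomonicRegion o H R) (hq : q ∈ gnomonicRegion o H R)
    (hd : ‖gnomonic o p - gnomonic o q‖ ≤ d) :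
    gnomonic o m ∈ middleSegment (2 + 6 * R * H ^ 2 * d)⁻¹ (gnomonic o p) (gnomonic o q) := by
  obtain rfl := hm.eq_midpoint (neg_one_lt_form hp.1 hq.1)
  have hle := form_le_mul_form_of_norm_sub_le hp hq hd
  have hge := form_le_mul_form_of_norm_sub_le hq hp (norm_sub_rev (gnomonic o p) _ ▸ hd)
  have hp0 := hp.1
  have hq0 := hq.1
  have hR : 0 ≤ R := (norm_nonneg _).trans hp.2.2
  have hd : 0 ≤ d := (norm_nonneg _).trans hd
  rw [gnomonic_midpoint hp0 hq0]
  set s := form κ o.coords p.coords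
  set t := form κ o.coords q.coords
  have weight_ge {s t : ℝ} (hs : 0 < s) (ht : 0 < t) (h : s ≤ (1 + 6 * R * H ^ 2 * d) * t) :
      (2 + 6 * R * H ^ 2 * d)⁻¹ ≤ t / (s + t) := by
    rw [inv_eq_one_div, div_le_div_iff₀ (by positivity) (by positivity)]
    linarith
  have hsum : t / (s + t) = 1 - s / (t + s) := by
    field_simp
    ring
  exact ⟨_, ⟨weight_ge hp0 hq0 hle, hsum.trans_le (sub_le_sub_left (weight_ge hq0 hp0 hge) _)⟩, rfl⟩

theorem sqrt_tangentInner_direction_le (hp : p ∈ gnomonicRegion o H R)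
    (hq : 0 < form κ o.coords q.coords) (hpq : ‖gnomonic o p - gnomonic o q‖ ≤ d) :
    √(tangentInner κ (direction p q) (direction p q)) ≤
      form κ o.coords p.coords * form κ o.coords q.coords * (4 * (R * d)) := by
  obtain ⟨hp, -, hpR⟩ := hp
  have hR : 0 ≤ R := (norm_nonneg _).trans hpR
  have hd : 0 ≤ d := (norm_nonneg _).trans hpq
  have hcross : p.coords ⨯₃ q.coords = (form κ o.coords p.coords * form κ o.coords q.coords) •
      gnomonic o p ⨯₃ (gnomonic o q - gnomonic o p) := by
    rw [map_sub, cross_self, sub_zero]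
    nth_rewrite 1 [← smul_gnomonic hp, ← smul_gnomonic hq]
    rw [LinearMap.map_smul₂, map_smul, smul_smul]
  rw [tangentInner_direction, hcross, tangentInner_smul_self]
  set s := form κ o.coords p.coords
  set t := form κ o.coords q.coords
  set a := gnomonic o p
  set b := gnomonic o q
  have hnorm : ‖a ⨯₃ (b - a)‖ ≤ 2 * (R * d) :=
    (norm_cross_le _ _).trans (by rw [norm_sub_rev b]; gcongr)
  refine Real.sqrt_le_iff.2 ⟨by positivity, ?_⟩
  calc (s * t) ^ 2 * tangentInner κ (a ⨯₃ (b - a)) (a ⨯₃ (b - a))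
      ≤ (s * t) ^ 2 * (3 * (2 * (R * d)) ^ 2) := by
        gcongr
        exact (tangentInner_self_le _ _).trans (by gcongr)
    _ ≤ (s * t) ^ 2 * (4 * (2 * (R * d)) ^ 2) := by
        gcongr
        norm_num
    _ = (s * t * (4 * (R * d))) ^ 2 := by ring

theorem triple_product_eq_mul_triple_product_gnomonic (hp : 0 < form κ o.coords p.coords)
    (hq : 0 < form κ o.coords q.coords) (hr : 0 < form κ o.coords r.coords) :
    p.coords ⬝ᵥ q.coords ⨯₃ r.coords =
      form κ o.coords p.coords * form κ o.coords q.coords * form κ o.coords r.coords *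
        (gnomonic o p ⬝ᵥ gnomonic o q ⨯₃ gnomonic o r) := by
  nth_rewrite 1 [← smul_gnomonic hp, ← smul_gnomonic hq, ← smul_gnomonic hr]
  rw [LinearMap.map_smul₂, map_smul, smul_dotProduct, dotProduct_smul, dotProduct_smul]
  simp only [smul_eq_mul]
  ring

theorem abs_triple_product_gnomonic_le (hp : p ∈ gnomonicRegion o H R)
    (hq : 0 < form κ o.coords q.coords) (hr : 0 < form κ o.coords r.coords)
    (hpq : ‖gnomonic o p - gnomonic o q‖ ≤ d) (hpr : ‖gnomonic o p - gnomonic o r‖ ≤ d) :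
    |gnomonic o p ⬝ᵥ gnomonic o q ⨯₃ gnomonic o r| ≤
      16 * H * R ^ 2 * d ^ 2 * Real.sin (angle q p r) := by
  have hR : 0 ≤ R := (norm_nonneg _).trans hp.2.2
  have hd : 0 ≤ d := (norm_nonneg _).trans hpq
  have hsin : 0 ≤ Real.sin (angle q p r) :=
    Real.sin_nonneg_of_nonneg_of_le_pi (Real.arccos_nonneg _) (Real.arccos_le_pi _)
  have htriple := sqrt_mul_sqrt_mul_sin_angle p q r
  have hq_le := sqrt_tangentInner_direction_le hp hq hpq
  have hr_le := sqrt_tangentInner_direction_le hp hr hpr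
  have hsplit := triple_product_eq_mul_triple_product_gnomonic hp.1 hq hr
  obtain ⟨hp, hpH, -⟩ := hp
  set s := form κ o.coords p.coords
  set t := form κ o.coords q.coords
  set w := form κ o.coords r.coords
  set v := gnomonic o p ⬝ᵥ gnomonic o q ⨯₃ gnomonic o r
  have hstw : 0 < s * t * w := by positivity
  calc |v| ≤ 16 * s * R ^ 2 * d ^ 2 * Real.sin (angle q p r) := by
        refine le_of_mul_le_mul_left ?_ hstw
        calc s * t * w * |v| = |p.coords ⬝ᵥ q.coords ⨯₃ r.coords| := by
              rw [hsplit, abs_mul, abs_of_pos hstw]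
          _ ≤ s * t * (4 * (R * d)) * (s * w * (4 * (R * d))) * Real.sin (angle q p r) := by
              rw [← htriple]
              gcongr
          _ = s * t * w * (16 * s * R ^ 2 * d ^ 2 * Real.sin (angle q p r)) := by ring
    _ ≤ 16 * H * R ^ 2 * d ^ 2 * Real.sin (angle q p r) := by gcongr

end ModelPlane

theorem mem_Ioo_of_le_sin {θ δ : ℝ} (hθ : θ ∈ Set.Icc 0 Real.pi) (hδ : 0 < δ)
    (h : δ ≤ Real.sin θ) : θ ∈ Set.Ioo δ (Real.pi - δ) := by
  have lt_of_le_sin {φ : ℝ} (hφ : 0 ≤ φ) (h : δ ≤ Real.sin φ) : δ < φ := by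
    refine h.trans_lt (Real.sin_lt (hφ.lt_of_ne ?_))
    rintro rfl
    exact (hδ.trans_le h).ne' Real.sin_zero
  exact ⟨lt_of_le_sin hθ.1 h,
    lt_sub_comm.1 (lt_of_le_sin (sub_nonneg.2 hθ.2) (Real.sin_pi_sub θ ▸ h))⟩

namespace GeodesicTriangle

open ModelPlane

variable {κ : ℝ} {o X Y Z : ModelPlane κ} {T t : GeodesicTriangle κ} {H R c L d₀ : ℝ}

/-- The triangle with the same vertices in cyclically permuted order, used to treat the three
vertices alike. -/
def rotate (T : GeodesicTriangle κ) : GeodesicTriangle κ :=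
  ⟨T.B, T.C, T.A⟩

/-- The property of triangles that is propagated through the subdivisions: the vertices lie in
`gnomonicRegion o H R`, and the gnomonic projection of the triangle satisfies the bound on the area
for some bound `d ≤ d₀` on its sides. -/
structure IsControlled (o : ModelPlane κ) (H R c L d₀ : ℝ) (T : GeodesicTriangle κ) : Prop where
  mem_A : T.A ∈ gnomonicRegion o H R
  mem_B : T.B ∈ gnomonicRegion o H R
  mem_C : T.C ∈ gnomonicRegion o H R
  exists_shapeBound : ∃ d ∈ Set.Ioc 0 d₀,
    ShapeBound d (areaBound c L d) (gnomonic o T.A) (gnomonic o T.B) (gnomonic o T.C)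

theorem IsControlled.rotate (h : T.IsControlled o H R c L d₀) :
    T.rotate.IsControlled o H R c L d₀ :=
  let ⟨hA, hB, hC, d, hd, hs⟩ := h
  ⟨hB, hC, hA, d, hd, hs.rotate⟩

theorem IsControlled.corner (h : T.IsControlled o H R c L d₀) (hH : 1 ≤ H) (hc : 0 ≤ c)
    (hL : 3 * (6 * R * H ^ 2) * (2 + 6 * R * H ^ 2 * d₀) ≤ L) (hY : IsMidpoint T.C T.A Y)
    (hZ : IsMidpoint T.A T.B Z) : IsControlled o H R c L d₀ ⟨T.A, Z, Y⟩ := by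
  obtain ⟨hA, hB, hC, d, hd, hs⟩ := h
  have hR : 0 ≤ R := (norm_nonneg _).trans hA.2.2
  have hK : 0 ≤ 6 * R * H ^ 2 := by positivity
  have hm : 0 ≤ (2 + 6 * R * H ^ 2 * d)⁻¹ :=
    inv_nonneg.2 (add_nonneg zero_le_two (mul_nonneg hK hd.1.le))
  refine ⟨hA, hZ.mem_gnomonicRegion hH hA hB, hY.mem_gnomonicRegion hH hC hA, _,
    one_sub_inv_mul_mem_Ioc hK hd,
    (hs.corner hm (hZ.gnomonic_mem_middleSegment hA hB hs.norm_sub_le₁) ?_).mono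
      (areaBound_sub_mul_le hc hK hd.1.le hd.2 hL)⟩
  rw [middleSegment_symm]
  exact hY.gnomonic_mem_middleSegment hC hA hs.norm_sub_le₃

theorem IsControlled.center (h : T.IsControlled o H R c L d₀) (hH : 1 ≤ H) (hc : 0 ≤ c)
    (hL : 3 * (6 * R * H ^ 2) * (2 + 6 * R * H ^ 2 * d₀) ≤ L) (hX : IsMidpoint T.B T.C X)
    (hY : IsMidpoint T.C T.A Y) (hZ : IsMidpoint T.A T.B Z) :
    IsControlled o H R c L d₀ ⟨X, Y, Z⟩ := by
  obtain ⟨hA, hB, hC, d, hd, hs⟩ := h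
  have hR : 0 ≤ R := (norm_nonneg _).trans hA.2.2
  have hK : 0 ≤ 6 * R * H ^ 2 := by positivity
  have hm : 0 ≤ (2 + 6 * R * H ^ 2 * d)⁻¹ :=
    inv_nonneg.2 (add_nonneg zero_le_two (mul_nonneg hK hd.1.le))
  exact ⟨hX.mem_gnomonicRegion hH hB hC, hY.mem_gnomonicRegion hH hC hA,
    hZ.mem_gnomonicRegion hH hA hB, _, one_sub_inv_mul_mem_Ioc hK hd,
    (hs.center hm (hX.gnomonic_mem_middleSegment hB hC hs.norm_sub_le₂)
      (hY.gnomonic_mem_middleSegment hC hA hs.norm_sub_le₃)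
      (hZ.gnomonic_mem_middleSegment hA hB hs.norm_sub_le₁)).mono
      (areaBound_sub_mul_le hc hK hd.1.le hd.2 hL)⟩

theorem IsControlled.of_isMedialPart (h : T.IsControlled o H R c L d₀) (hH : 1 ≤ H) (hc : 0 ≤ c)
    (hL : 3 * (6 * R * H ^ 2) * (2 + 6 * R * H ^ 2 * d₀) ≤ L) (ht : T.IsMedialPart t) :
    t.IsControlled o H R c L d₀ := by
  obtain ⟨X, Y, Z, hX, hY, hZ, rfl | rfl | rfl | rfl⟩ := ht
  · exact h.corner hH hc hL hY hZ
  · exact (h.rotate.corner hH hc hL hZ hX).rotate.rotate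
  · exact (h.rotate.rotate.corner hH hc hL hX hY).rotate
  · exact h.center hH hc hL hX hY hZ

theorem IsControlled.of_mem_subdivision (h : T.IsControlled o H R c L d₀) (hH : 1 ≤ H)
    (hc : 0 ≤ c) (hL : 3 * (6 * R * H ^ 2) * (2 + 6 * R * H ^ 2 * d₀) ≤ L) (n : ℕ)
    (ht : t ∈ T.subdivision n) : t.IsControlled o H R c L d₀ := by
  induction n generalizing t with
  | zero =>
    obtain rfl := ht
    exact h
  | succ n ih =>
    obtain ⟨s, hs, hst⟩ := ht
    exact (ih hs).of_isMedialPart hH hc hL hst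

theorem IsControlled.le_mul_sin_angle (h : T.IsControlled o H R c L d₀) (hc : 0 ≤ c)
    (hL : 0 ≤ L) : c ≤ 16 * H * R ^ 2 * Real.sin (angle T.B T.A T.C) := by
  obtain ⟨hA, hB, hC, d, ⟨hd, -⟩, hs⟩ := h
  refine le_of_mul_le_mul_right ?_ (pow_pos hd 2)
  calc c * d ^ 2 ≤ areaBound c L d := mul_sq_le_areaBound hc hL hd.le
    _ ≤ |gnomonic o T.A ⬝ᵥ gnomonic o T.B ⨯₃ gnomonic o T.C| := hs.le_area
    _ ≤ 16 * H * R ^ 2 * d ^ 2 * Real.sin (angle T.B T.A T.C) :=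
      abs_triple_product_gnomonic_le hA hB.1 hC.1 hs.norm_sub_le₁
        (norm_sub_rev (gnomonic o T.C) _ ▸ hs.norm_sub_le₃)
    _ = 16 * H * R ^ 2 * Real.sin (angle T.B T.A T.C) * d ^ 2 := by ring

theorem IsControlled.mem_Ioo_of_hasAngle (h : T.IsControlled o H R c L d₀) (hH : 0 < H)
    (hR : 0 < R) (hc : 0 < c) (hL : 0 ≤ L) {θ : ℝ} (hθ : T.HasAngle θ) :
    θ ∈ Set.Ioo (c / (16 * H * R ^ 2)) (Real.pi - c / (16 * H * R ^ 2)) := by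
  have angle_mem {t : GeodesicTriangle κ} (ht : t.IsControlled o H R c L d₀) :
      angle t.B t.A t.C ∈ Set.Ioo (c / (16 * H * R ^ 2)) (Real.pi - c / (16 * H * R ^ 2)) :=
    mem_Ioo_of_le_sin ⟨Real.arccos_nonneg _, Real.arccos_le_pi _⟩ (by positivity)
      ((div_le_iff₀' (by positivity)).2 (ht.le_mul_sin_angle hc.le hL))
  obtain rfl | rfl | rfl := hθ
  · exact angle_mem h
  · exact angle_mem (t := T.rotate) h.rotate
  · exact angle_mem (t := T.rotate.rotate) h.rotate.rotate

theorem exists_forall_form_pos (T : GeodesicTriangle κ) (hemi : 0 < κ → T.InOpenHemisphere) :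
    ∃ o : ModelPlane κ, 0 < form κ o.coords T.A.coords ∧ 0 < form κ o.coords T.B.coords ∧
      0 < form κ o.coords T.C.coords := by
  rcases le_or_gt κ 0 with hκ | hκ
  · have form_pos (p : ModelPlane κ) : 0 < form κ T.A.coords p.coords :=
      one_pos.trans_le (one_le_form_of_nonpos hκ _ _)
    exact ⟨T.A, form_pos _, form_pos _, form_pos _⟩
  · obtain ⟨o, hA, hB, hC⟩ := hemi hκ
    have form_pos {p : ModelPlane κ} (hp : ModelPlane.dist o p < Real.pi / (2 * √κ)) :
        0 < form κ o.coords p.coords := by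
      rw [ModelPlane.dist, if_pos hκ, ← div_div,
        div_lt_div_iff_of_pos_right (Real.sqrt_pos.2 hκ)] at hp
      exact Real.arccos_lt_pi_div_two.1 hp
    exact ⟨o, form_pos hA, form_pos hB, form_pos hC⟩

theorem IsNondegenerate.exists_isControlled (hT : T.IsNondegenerate)
    (hA : 0 < form κ o.coords T.A.coords) (hB : 0 < form κ o.coords T.B.coords)
    (hC : 0 < form κ o.coords T.C.coords) :
    ∃ H R d₀ : ℝ, 1 ≤ H ∧ 0 < R ∧ 0 < d₀ ∧ ∀ L, ∃ c > 0, T.IsControlled o H R c L d₀ := by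
  have exists_pos_ge (x y z : ℝ) : ∃ M, 1 ≤ M ∧ x ≤ M ∧ y ≤ M ∧ z ≤ M :=
    ⟨max 1 (max x (max y z)), by simp⟩
  obtain ⟨H, hH, hAH, hBH, hCH⟩ := exists_pos_ge (form κ o.coords T.A.coords)
    (form κ o.coords T.B.coords) (form κ o.coords T.C.coords)
  obtain ⟨R, hR, hAR, hBR, hCR⟩ :=
    exists_pos_ge ‖gnomonic o T.A‖ ‖gnomonic o T.B‖ ‖gnomonic o T.C‖
  obtain ⟨d, hd, hAB, hBC, hCA⟩ := exists_pos_ge ‖gnomonic o T.A - gnomonic o T.B‖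
    ‖gnomonic o T.B - gnomonic o T.C‖ ‖gnomonic o T.C - gnomonic o T.A‖
  have hd0 : 0 < d := one_pos.trans_le hd
  have htriple := triple_product_ne_zero hT
  rw [triple_product_eq_mul_triple_product_gnomonic hA hB hC] at htriple
  have hv := abs_pos.2 (right_ne_zero_of_mul htriple)
  refine ⟨H, R, d, hH, one_pos.trans_le hR, hd0, fun L =>
    ⟨|gnomonic o T.A ⬝ᵥ gnomonic o T.B ⨯₃ gnomonic o T.C| / (d ^ 2 * Real.exp (L * d)),
      by positivity, ⟨hA, hAH, hAR⟩, ⟨hB, hBH, hBR⟩, ⟨hC, hCH, hCR⟩, d, ⟨hd0, le_rfl⟩,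
      hAB, hBC, hCA, ?_⟩⟩
  rw [areaBound, mul_assoc, div_mul_cancel₀ _ (by positivity)]

end GeodesicTriangle

theorem theoremA (κ : ℝ) (T : GeodesicTriangle κ) (hT : T.IsNondegenerate)
    (hemi : 0 < κ → T.InOpenHemisphere) :
    ∃ δ : ℝ, 0 < δ ∧ ∀ n : ℕ, ∀ t ∈ T.subdivision n, ∀ θ : ℝ, t.HasAngle θ →
      θ ∈ Set.Ioo δ (Real.pi - δ) := by
  obtain ⟨o, hA, hB, hC⟩ := T.exists_forall_form_pos hemi
  obtain ⟨H, R, d₀, hH, hR, hd₀, hcontrol⟩ := hT.exists_isControlled hA hB hC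
  obtain ⟨c, hc, hT⟩ := hcontrol (3 * (6 * R * H ^ 2) * (2 + 6 * R * H ^ 2 * d₀))
  have hH0 : 0 < H := one_pos.trans_le hH
  refine ⟨c / (16 * H * R ^ 2), by positivity, fun n t ht θ hθ => ?_⟩
  have ht_control := hT.of_mem_subdivision hH hc.le le_rfl n ht
  exact ht_control.mem_Ioo_of_hasAngle hH0 hR hc (by positivity) hθ
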